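/- Let $m,n\ge 1$, let $H_1\in\mathbb C^{m\times m}$, $H_2\in\mathbb C^{n\times n}$, $E\in\mathbb C^{n\times m}$, and let $$A=\begin{pmatrix}H_1&E^*\\E&H_2\end{pmatrix},\qquad \widetilde A=\begin{pmatrix}H_1&0\\0&H_2\end{pmatrix}$$ be Hermitian, with eigenvalues $\lambda_1\ge\cdots\ge\lambda_{m+n}$ and $\widetilde\lambda_1\ge\cdots\ge\widetilde\lambda_{m+n}$, respectively, counted with multiplicity. Let $\lambda(X)$ denote the spectrum of a square matrix $X$ and $\|\cdot\|$ the spectral norm (largest singular value). For $1\le i\le m+n$ define $$\eta_i=\begin{cases}\min_{\mu_2\in\lambda(H_2)}|\widetilde\lambda_i-\mu_2| & \text{if }\widetilde\lambda_i\in\lambda(H_1),\\ \min_{\mu_1\in\lambda(H_1)}|\widetilde\lambda_i-\mu_1| & \text{if }\widetilde\lambda_i\in\lambda(H_2),\end{cases}\qquad \eta=\min_{1\le i\le m+n}\eta_i.$$ At least one of the two cases applies to each $i$, and if both apply they give the same value, $\eta_i=0$. Moreover $$\eta=\min_{\mu_1\in\lambda(H_1),\,\mu_2\in\lambda(H_2)}|\mu_1-\mu_2|,$$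 and for every $i=1,\dots,m+n$ $$|\lambda_i-\widetilde\lambda_i|\le\frac{2\|E\|^2}{\eta_i+\sqrt{\eta_i^2+4\|E\|^2}}\le\frac{2\|E\|^2}{\eta+\sqrt{\eta^2+4\|E\|^2}},$$ where a fraction of the form $0/0$ (which occurs only if $E=0$) is read as $0$. -/

import Mathlib

open scoped Matrix.Norms.L2Operator

namespace BlockPerturbation

/-- The Hermitian block matrix with diagonal blocks `H₁`, `H₂` and lower left block `E`. -/
abbrev full {m n : ℕ} (H₁ : Matrix (Fin m) (Fin m) ℂ) (H₂ : Matrix (Fin n) (Fin n) ℂ)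
    (E : Matrix (Fin n) (Fin m) ℂ) : Matrix (Fin m ⊕ Fin n) (Fin m ⊕ Fin n) ℂ :=
  Matrix.fromBlocks H₁ E.conjTranspose E H₂

/-- The block diagonal matrix with diagonal blocks `H₁`, `H₂`. -/
abbrev diag {m n : ℕ} (H₁ : Matrix (Fin m) (Fin m) ℂ) (H₂ : Matrix (Fin n) (Fin n) ℂ) :
    Matrix (Fin m ⊕ Fin n) (Fin m ⊕ Fin n) ℂ :=
  Matrix.fromBlocks H₁ 0 0 H₂

/-- The set of distances `|x - μ|`, where `μ` runs over the (real) spectrum of `H`. -/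
def distances {k : ℕ} (x : ℝ) (H : Matrix (Fin k) (Fin k) ℂ) : Set ℝ :=
  {d | ∃ μ ∈ spectrum ℝ H, d = |x - μ|}

open Classical in
/-- The gap of an eigenvalue `x` of one of the blocks `H₁`, `H₂`: its distance to the spectrum of
the other block (it is `0` if `x` is an eigenvalue of both). -/
noncomputable def gapAt {m n : ℕ} (H₁ : Matrix (Fin m) (Fin m) ℂ) (H₂ : Matrix (Fin n) (Fin n) ℂ)
    (x : ℝ) : ℝ :=
  if x ∈ spectrum ℝ H₁ then sInf (distances x H₂) else sInf (distances x H₁)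

/-- The gap `η i` of the `i`-th eigenvalue, in decreasing order, of the block diagonal matrix. -/
noncomputable def eta {m n : ℕ} {H₁ : Matrix (Fin m) (Fin m) ℂ} {H₂ : Matrix (Fin n) (Fin n) ℂ}
    (hD : (diag H₁ H₂).IsHermitian) (i : Fin (Fintype.card (Fin m ⊕ Fin n))) : ℝ :=
  gapAt H₁ H₂ (hD.eigenvalues₀ i)

/-- The smallest of the gaps `η i`. -/
noncomputable def etaMin {m n : ℕ} {H₁ : Matrix (Fin m) (Fin m) ℂ}
    {H₂ : Matrix (Fin n) (Fin n) ℂ} (hD : (diag H₁ H₂).IsHermitian) : ℝ :=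
  ⨅ i, eta hD i

/-- The bound `2 e² / (t + √(t² + 4 e²))`. For `e = t = 0` the value is `0`. -/
noncomputable def bound (e t : ℝ) : ℝ :=
  2 * e ^ 2 / (t + Real.sqrt (t ^ 2 + 4 * e ^ 2))

end BlockPerturbation

namespace BlockPerturbation

open Matrix

/-! Write x for the i-th eigenvalue of the block diagonal matrix and δ for the bound, the
nonnegative root of δ(δ + η_i) = ‖E‖² (`bound_mul_bound_add`). If x is an eigenvalue of H₁, the
eigenvalues of H₂ avoid the open interval of radius η_i around x; the other case is symmetric.

Suppose A had more eigenvalues above x + δ than H₁ and H₂ together have above x. By dimension count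
some nonzero (u, v) lies in the corresponding spectral subspace of A, while u and v avoid the
eigenvectors of H₁ and H₂ above x. The form of A then exceeds (x + δ)(|u|² + |v|²), yet is at most
x|u|² + (x - η_i)|v|² + 2‖E‖|u||v|, which AM-GM contradicts. This is `card_gt_le_of_form_le`;
applied to -A it gives the lower bound. -/

/-- The sum of the squared absolute values of the entries of a complex vector. -/
noncomputable def normSq {ι : Type*} [Fintype ι] (w : ι → ℂ) : ℝ := ∑ j, ‖w j‖ ^ 2

/-- The quadratic form of a complex matrix. -/
noncomputable def quadForm {ι : Type*} [Fintype ι] (A : Matrix ι ι ℂ) (w : ι → ℂ) : ℝ :=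
  (star w ⬝ᵥ A *ᵥ w).re

lemma normSq_nonneg {ι : Type*} [Fintype ι] (w : ι → ℂ) : 0 ≤ normSq w :=
  Finset.sum_nonneg fun _ _ => by positivity

lemma normSq_pos {ι : Type*} [Fintype ι] {w : ι → ℂ} (hw : w ≠ 0) : 0 < normSq w := by
  obtain ⟨j, hj⟩ := Function.ne_iff.mp hw
  exact Finset.sum_pos' (fun _ _ => by positivity)
    ⟨j, Finset.mem_univ j, by have := norm_pos_iff.mpr hj; positivity⟩

lemma normSq_eq_norm_sq {ι : Type*} [Fintype ι] (w : ι → ℂ) :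
    normSq w = ‖WithLp.toLp 2 w‖ ^ 2 := by
  rw [EuclideanSpace.norm_sq_eq]; rfl

lemma normSq_sum {ι κ : Type*} [Fintype ι] [Fintype κ] (u : ι → ℂ) (v : κ → ℂ) :
    normSq (Sum.elim u v) = normSq u + normSq v := by
  simp [normSq]

lemma star_dotProduct_self {ι : Type*} [Fintype ι] (w : ι → ℂ) :
    star w ⬝ᵥ w = (normSq w : ℂ) := by
  simp [normSq, dotProduct, Complex.conj_mul']

/-! ### Quadratic forms in eigenbases and the dimension count -/

lemma exists_diagonalization {ι : Type*} [Fintype ι] [DecidableEq ι] {A : Matrix ι ι ℂ}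
    (hA : A.IsHermitian) :
    ∃ P : Matrix ι ι ℂ, ∀ w, normSq (P *ᵥ w) = normSq w ∧
      quadForm A w = ∑ j, hA.eigenvalues j * ‖(P *ᵥ w) j‖ ^ 2 := by
  set U : Matrix ι ι ℂ := ↑hA.eigenvectorUnitary
  have hUU : U * star U = 1 := Unitary.coe_mul_star_self hA.eigenvectorUnitary
  have hAU : A = U * diagonal (RCLike.ofReal ∘ hA.eigenvalues) * star U := by
    conv_lhs => rw [hA.spectral_theorem, Unitary.conjStarAlgAut_apply]
  have hs : ∀ w, star w ᵥ* U = star (star U *ᵥ w) := fun w => by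
    rw [star_mulVec, star_eq_conjTranspose, conjTranspose_conjTranspose]
  refine ⟨star U, fun w => ⟨?_, ?_⟩⟩
  · have h : star (star U *ᵥ w) ⬝ᵥ (star U *ᵥ w) = star w ⬝ᵥ w := by
      rw [← hs, ← dotProduct_mulVec, mulVec_mulVec, hUU, one_mulVec]
    rw [star_dotProduct_self, star_dotProduct_self] at h
    exact_mod_cast h
  · have h : star w ⬝ᵥ A *ᵥ w = star (star U *ᵥ w) ⬝ᵥ
        (diagonal (RCLike.ofReal ∘ hA.eigenvalues) *ᵥ (star U *ᵥ w)) := by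
      rw [← hs, ← dotProduct_mulVec, mulVec_mulVec, mulVec_mulVec, ← hAU]
    rw [quadForm, h]
    simp only [dotProduct, mulVec_diagonal, Pi.star_apply, Complex.re_sum, Function.comp_apply]
    refine Finset.sum_congr rfl fun j _ => ?_
    rw [mul_left_comm, RCLike.star_def, Complex.conj_mul', ← Complex.ofReal_pow]
    exact Complex.re_ofReal_mul _ _

/-- A homogeneous linear system with fewer equations than unknowns has a nonzero solution. -/
lemma exists_ne_zero_of_card_lt {ι κ : Type*} [Fintype ι] [Fintype κ]
    (f : (ι → ℂ) →ₗ[ℂ] (κ → ℂ)) (h : Fintype.card κ < Fintype.card ι) :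
    ∃ w ≠ 0, f w = 0 := by
  have : LinearMap.ker f ≠ ⊥ := LinearMap.ker_ne_bot_of_finrank_lt (by simpa using h)
  obtain ⟨w, hw, hw0⟩ := (Submodule.ne_bot_iff _).mp this
  exact ⟨w, hw0, hw⟩

lemma sum_mul_le_of_forall {ι : Type*} [Fintype ι] {d : ι → ℝ} {c : ℝ} {z : ι → ℂ}
    (h : ∀ j, c < d j → z j = 0) : ∑ j, d j * ‖z j‖ ^ 2 ≤ c * normSq z := by
  rw [normSq, Finset.mul_sum]
  refine Finset.sum_le_sum fun j _ => ?_
  by_cases hj : c < d j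
  · simp [h j hj]
  · gcongr
    exact not_lt.mp hj

lemma lt_sum_mul_of_forall {ι : Type*} [Fintype ι] {d : ι → ℝ} {c : ℝ} {z : ι → ℂ}
    (h : ∀ j, d j ≤ c → z j = 0) (hz : 0 < normSq z) : c * normSq z < ∑ j, d j * ‖z j‖ ^ 2 := by
  obtain ⟨k, hk⟩ : ∃ k, z k ≠ 0 := by
    by_contra! hc
    simp [normSq, hc] at hz
  rw [normSq, Finset.mul_sum]
  refine Finset.sum_lt_sum (fun j _ => ?_) ⟨k, Finset.mem_univ k, ?_⟩
  · by_cases hj : d j ≤ c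
    · simp [h j hj]
    · gcongr
      exact (not_le.mp hj).le
  · have := norm_pos_iff.mpr hk
    have : c < d k := not_le.mp fun hc => hk (h k hc)
    gcongr

/-- If a form on a direct sum is bounded by two diagonalizable forms plus a coupling term of size
`e`, then it has at most as many eigenvalues above `x + δ` as the two forms have above `x`,
provided that the eigenvalues of the two forms that are at most `x` are in fact at most `x - a` and
`x - b`, respectively, where `e ^ 2 ≤ (δ + a) * (δ + b)`. -/
lemma card_gt_le_of_form_le {ι κ : Type*} [Fintype ι] [Fintype κ]
    {P : Matrix (ι ⊕ κ) (ι ⊕ κ) ℂ} {P₁ : Matrix ι ι ℂ} {P₂ : Matrix κ κ ℂ}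
    {d : ι ⊕ κ → ℝ} {d₁ : ι → ℝ} {d₂ : κ → ℝ}
    (hP : ∀ w, normSq (P *ᵥ w) = normSq w) (hP₁ : ∀ w, normSq (P₁ *ᵥ w) = normSq w)
    (hP₂ : ∀ w, normSq (P₂ *ᵥ w) = normSq w) {e : ℝ}
    (hq : ∀ u v, ∑ j, d j * ‖(P *ᵥ Sum.elim u v) j‖ ^ 2 ≤
      ∑ j, d₁ j * ‖(P₁ *ᵥ u) j‖ ^ 2 + ∑ j, d₂ j * ‖(P₂ *ᵥ v) j‖ ^ 2 +
        2 * e * (√(normSq u) * √(normSq v)))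
    {x a b δ : ℝ} (h₁ : ∀ j, d₁ j ≤ x → d₁ j ≤ x - a) (h₂ : ∀ j, d₂ j ≤ x → d₂ j ≤ x - b)
    (ha : 0 ≤ δ + a) (hb : 0 ≤ δ + b) (he : e ^ 2 ≤ (δ + a) * (δ + b)) :
    Fintype.card {j // x + δ < d j} ≤ Fintype.card {j // x < d₁ j} +
      Fintype.card {j // x < d₂ j} := by
  by_contra! hcard
  have hcompl := Fintype.card_subtype_compl (fun j => x + δ < d j)
  have hle := Fintype.card_subtype_le (fun j => x + δ < d j)
  -- The kernel of `f` is the intersection of the three spectral subspaces; the negated `hcard`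
  -- makes the equations fewer than the unknowns.
  let f : (ι ⊕ κ → ℂ) →ₗ[ℂ]
      ({j // ¬ x + δ < d j} ⊕ ({j // x < d₁ j} ⊕ {j // x < d₂ j}) → ℂ) :=
    { toFun := fun w => Sum.elim (fun j => (P *ᵥ w) j)
        (Sum.elim (fun j => (P₁ *ᵥ (w ∘ Sum.inl)) j) (fun j => (P₂ *ᵥ (w ∘ Sum.inr)) j))
      map_add' := fun w w' => by
        ext (j | j | j) <;> simp [mulVec_add, Pi.add_comp]
      map_smul' := fun c w => by
        ext (j | j | j) <;> simp [mulVec_smul, Pi.smul_comp] }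
  obtain ⟨w, hw, hfw⟩ := exists_ne_zero_of_card_lt f (by
    simp only [Fintype.card_sum] at hcompl hle ⊢
    omega)
  obtain ⟨u, v, rfl⟩ : ∃ u v, w = Sum.elim u v :=
    ⟨w ∘ Sum.inl, w ∘ Sum.inr, (Sum.elim_comp_inl_inr w).symm⟩
  have hz : ∀ j, d j ≤ x + δ → (P *ᵥ Sum.elim u v) j = 0 := fun j hj =>
    congrFun hfw (Sum.inl ⟨j, not_lt.mpr hj⟩)
  have hz₁ : ∀ j, x < d₁ j → (P₁ *ᵥ u) j = 0 := fun j hj =>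
    congrFun hfw (Sum.inr (Sum.inl ⟨j, hj⟩))
  have hz₂ : ∀ j, x < d₂ j → (P₂ *ᵥ v) j = 0 := fun j hj =>
    congrFun hfw (Sum.inr (Sum.inr ⟨j, hj⟩))
  have hlow := lt_sum_mul_of_forall hz (by rw [hP]; exact normSq_pos hw)
  -- By the gap hypothesis, an eigenvalue above `x - a` is already above `x`, where the coordinate
  -- vanishes.
  have hup₁ := sum_mul_le_of_forall (c := x - a) fun j hj =>
    hz₁ j (not_le.mp fun hc => absurd (h₁ j hc) (not_le.mpr hj))
  have hup₂ := sum_mul_le_of_forall (c := x - b) fun j hj =>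
    hz₂ j (not_le.mp fun hc => absurd (h₂ j hc) (not_le.mpr hj))
  rw [hP, normSq_sum] at hlow
  rw [hP₁] at hup₁
  rw [hP₂] at hup₂
  have hqw := hq u v
  have hs : 2 * e * (√(normSq u) * √(normSq v)) ≤ (δ + a) * normSq u + (δ + b) * normSq v := by
    have hu := Real.sq_sqrt (normSq_nonneg u)
    have hv := Real.sq_sqrt (normSq_nonneg v)
    have hab : e ≤ √(δ + a) * √(δ + b) := by
      rw [← Real.sqrt_mul ha]
      exact Real.le_sqrt_of_sq_le he
    have hmul := mul_le_mul_of_nonneg_right hab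
      (mul_nonneg (Real.sqrt_nonneg (normSq u)) (Real.sqrt_nonneg (normSq v)))
    -- AM-GM, weighted by the two gaps.
    have hsq := sq_nonneg (√(δ + a) * √(normSq u) - √(δ + b) * √(normSq v))
    rw [sub_sq, mul_pow, mul_pow, hu, hv, Real.sq_sqrt ha, Real.sq_sqrt hb] at hsq
    linarith
  linarith

lemma norm_dotProduct_mulVec_le {m n : ℕ} (E : Matrix (Fin n) (Fin m) ℂ) (u : Fin m → ℂ)
    (v : Fin n → ℂ) : ‖star v ⬝ᵥ E *ᵥ u‖ ≤ ‖E‖ * (√(normSq u) * √(normSq v)) := by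
  have h : star v ⬝ᵥ E *ᵥ u = inner ℂ (WithLp.toLp 2 v) (WithLp.toLp 2 (E *ᵥ u)) := by
    rw [EuclideanSpace.inner_toLp_toLp, dotProduct_comm]
  rw [h, normSq_eq_norm_sq, normSq_eq_norm_sq, Real.sqrt_sq (norm_nonneg _),
    Real.sqrt_sq (norm_nonneg _)]
  have h1 := norm_inner_le_norm (𝕜 := ℂ) (WithLp.toLp 2 v) (WithLp.toLp 2 (E *ᵥ u))
  have h2 := mul_le_mul_of_nonneg_left (l2_opNorm_mulVec E (WithLp.toLp 2 u))
    (norm_nonneg (WithLp.toLp 2 v))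
  calc _ ≤ _ := h1
    _ ≤ _ := h2
    _ = _ := by ring

lemma quadForm_full {m n : ℕ} (H₁ : Matrix (Fin m) (Fin m) ℂ) (H₂ : Matrix (Fin n) (Fin n) ℂ)
    (E : Matrix (Fin n) (Fin m) ℂ) (u : Fin m → ℂ) (v : Fin n → ℂ) :
    quadForm (full H₁ H₂ E) (Sum.elim u v) =
      quadForm H₁ u + quadForm H₂ v + 2 * (star v ⬝ᵥ E *ᵥ u).re := by
  have hs : star (Sum.elim u v) = Sum.elim (star u) (star v) := by
    ext (j | j) <;> simp
  have hc : (star u ⬝ᵥ E.conjTranspose *ᵥ v).re = (star v ⬝ᵥ E *ᵥ u).re := by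
    rw [dotProduct_mulVec, ← star_mulVec, star_dotProduct, dotProduct_comm, dotProduct_star]
    simp
  rw [quadForm, fromBlocks_mulVec, hs]
  simp only [Sum.elim_comp_inl, Sum.elim_comp_inr, sumElim_dotProduct_sumElim,
    dotProduct_add, Complex.add_re, hc, quadForm]
  ring

lemma abs_quadForm_full_sub_le {m n : ℕ} (H₁ : Matrix (Fin m) (Fin m) ℂ)
    (H₂ : Matrix (Fin n) (Fin n) ℂ) (E : Matrix (Fin n) (Fin m) ℂ) (u : Fin m → ℂ)
    (v : Fin n → ℂ) :
    |quadForm (full H₁ H₂ E) (Sum.elim u v) - (quadForm H₁ u + quadForm H₂ v)| ≤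
      2 * ‖E‖ * (√(normSq u) * √(normSq v)) := by
  have h := (Complex.abs_re_le_norm _).trans (norm_dotProduct_mulVec_le E u v)
  rw [quadForm_full, add_sub_cancel_left, abs_mul, abs_two]
  linarith

/-! ### Eigenvalue counts via characteristic polynomials -/

section Counting

variable {ι : Type*} [Fintype ι] [DecidableEq ι] {A : Matrix ι ι ℂ}

lemma map_eigenvalues₀ (hA : A.IsHermitian) :
    (Finset.univ.val.map hA.eigenvalues₀) = Finset.univ.val.map hA.eigenvalues := by
  have h := hA.roots_charpoly_eq_eigenvalues₀.symm.trans hA.roots_charpoly_eq_eigenvalues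
  rw [← Multiset.map_map, ← Multiset.map_map] at h
  exact Multiset.map_injective (RCLike.ofReal_injective (K := ℂ)) h

lemma card_subtype_eq_countP {α : Type*} [Fintype α] (d : α → ℝ) (p : ℝ → Prop)
    [DecidablePred p] :
    Fintype.card {j // p (d j)} = (Finset.univ.val.map d).countP p := by
  rw [Multiset.countP_map, Fintype.card_subtype]
  rfl

lemma map_eigenvalues_diag {m n : ℕ} {H₁ : Matrix (Fin m) (Fin m) ℂ}
    {H₂ : Matrix (Fin n) (Fin n) ℂ} (h₁ : H₁.IsHermitian) (h₂ : H₂.IsHermitian)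
    (hD : (diag H₁ H₂).IsHermitian) :
    Finset.univ.val.map hD.eigenvalues₀ =
      Finset.univ.val.map h₁.eigenvalues + Finset.univ.val.map h₂.eigenvalues := by
  have h := congrArg Polynomial.roots (charpoly_fromBlocks_zero₁₂ H₁ 0 H₂)
  rw [Polynomial.roots_mul (mul_ne_zero (charpoly_monic _).ne_zero (charpoly_monic _).ne_zero),
    hD.roots_charpoly_eq_eigenvalues₀, h₁.roots_charpoly_eq_eigenvalues,
    h₂.roots_charpoly_eq_eigenvalues, ← Multiset.map_map, ← Multiset.map_map,
    ← Multiset.map_map, ← Multiset.map_add] at h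
  exact Multiset.map_injective (RCLike.ofReal_injective (K := ℂ)) h

lemma card_eigenvalues_diag {m n : ℕ} {H₁ : Matrix (Fin m) (Fin m) ℂ}
    {H₂ : Matrix (Fin n) (Fin n) ℂ} (h₁ : H₁.IsHermitian) (h₂ : H₂.IsHermitian)
    (hD : (diag H₁ H₂).IsHermitian) (p : ℝ → Prop) [DecidablePred p] :
    Fintype.card {j // p (hD.eigenvalues₀ j)} =
      Fintype.card {j // p (h₁.eigenvalues j)} + Fintype.card {j // p (h₂.eigenvalues j)} := by
  rw [card_subtype_eq_countP, card_subtype_eq_countP, card_subtype_eq_countP,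
    map_eigenvalues_diag h₁ h₂ hD, Multiset.countP_add]

lemma card_eigenvalues₀ (hA : A.IsHermitian) (p : ℝ → Prop) [DecidablePred p] :
    Fintype.card {j // p (hA.eigenvalues₀ j)} = Fintype.card {j // p (hA.eigenvalues j)} := by
  rw [card_subtype_eq_countP, card_subtype_eq_countP, map_eigenvalues₀]

end Counting

/-- If `c < f i`, the indices up to and including `i` all count for `f`, but only indices strictly
below `i` can count for `g`. Strict inequalities make ties harmless. -/
lemma le_of_card_gt_le {N : ℕ} {f g : Fin N → ℝ} (hf : Antitone f) (hg : Antitone g) {i : Fin N}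
    {c : ℝ} (h : Fintype.card {j // c < f j} ≤ Fintype.card {j // g i < g j}) : f i ≤ c := by
  by_contra! hc
  rw [Fintype.card_subtype, Fintype.card_subtype] at h
  have h1 := Finset.card_le_card (s := Finset.Iic i) (t := Finset.univ.filter fun j => c < f j)
    fun j hj => by simpa using hc.trans_le (hf (Finset.mem_Iic.mp hj))
  have h2 := Finset.card_le_card (s := Finset.univ.filter fun j => g i < g j) (t := Finset.Iio i)
    fun j hj => Finset.mem_Iio.mpr (hg.reflect_lt (by simpa using hj))
  rw [Fin.card_Iic] at h1
  rw [Fin.card_Iio] at h2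
  omega

lemma le_of_card_lt_le {N : ℕ} {f g : Fin N → ℝ} (hf : Antitone f) (hg : Antitone g) {i : Fin N}
    {c : ℝ} (h : Fintype.card {j // f j < c} ≤ Fintype.card {j // g j < g i}) : c ≤ f i := by
  by_contra! hc
  rw [Fintype.card_subtype, Fintype.card_subtype] at h
  have h1 := Finset.card_le_card (s := Finset.Ici i) (t := Finset.univ.filter fun j => f j < c)
    fun j hj => by simpa using (hf (Finset.mem_Ici.mp hj)).trans_lt hc
  have h2 := Finset.card_le_card (s := Finset.univ.filter fun j => g j < g i) (t := Finset.Ioi i)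
    fun j hj => Finset.mem_Ioi.mpr (hg.reflect_lt (by simpa using hj))
  rw [Fin.card_Ici] at h1
  rw [Fin.card_Ioi] at h2
  omega

/-- If the eigenvalues of `H₁` and `H₂` have distance at least `a` and `b`, respectively, from the
`i`-th eigenvalue of the block diagonal matrix, then the `i`-th eigenvalue of the full matrix differs
from the latter by at most `δ` as soon as `‖E‖ ^ 2 ≤ (δ + a) * (δ + b)`. -/
lemma abs_eigenvalues_sub_le {m n : ℕ} {H₁ : Matrix (Fin m) (Fin m) ℂ}
    {H₂ : Matrix (Fin n) (Fin n) ℂ} {E : Matrix (Fin n) (Fin m) ℂ}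
    (h₁ : H₁.IsHermitian) (h₂ : H₂.IsHermitian)
    (hA : (full H₁ H₂ E).IsHermitian) (hD : (diag H₁ H₂).IsHermitian)
    (i : Fin (Fintype.card (Fin m ⊕ Fin n))) {a b δ : ℝ}
    (ha : ∀ j, a ≤ |hD.eigenvalues₀ i - h₁.eigenvalues j|)
    (hb : ∀ j, b ≤ |hD.eigenvalues₀ i - h₂.eigenvalues j|)
    (ha' : 0 ≤ δ + a) (hb' : 0 ≤ δ + b) (he : ‖E‖ ^ 2 ≤ (δ + a) * (δ + b)) :
    |hA.eigenvalues₀ i - hD.eigenvalues₀ i| ≤ δ := by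
  obtain ⟨P, hP⟩ := exists_diagonalization hA
  obtain ⟨P₁, hP₁⟩ := exists_diagonalization h₁
  obtain ⟨P₂, hP₂⟩ := exists_diagonalization h₂
  have hq := abs_quadForm_full_sub_le H₁ H₂ E
  simp only [(hP _).2, (hP₁ _).2, (hP₂ _).2] at hq
  have hup : hA.eigenvalues₀ i ≤ hD.eigenvalues₀ i + δ := by
    refine le_of_card_gt_le hA.eigenvalues₀_antitone hD.eigenvalues₀_antitone ?_
    rw [card_eigenvalues₀ hA fun y => hD.eigenvalues₀ i + δ < y,
      card_eigenvalues_diag h₁ h₂ hD fun y => hD.eigenvalues₀ i < y]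
    refine card_gt_le_of_form_le (fun w => (hP w).1) (fun w => (hP₁ w).1) (fun w => (hP₂ w).1)
      (e := ‖E‖) (fun u v => ?_) (fun j hj => ?_) (fun j hj => ?_) ha' hb' he
    · linarith [(abs_le.mp (hq u v)).2]
    · have := ha j
      rw [abs_of_nonneg (sub_nonneg.mpr hj)] at this
      linarith
    · have := hb j
      rw [abs_of_nonneg (sub_nonneg.mpr hj)] at this
      linarith
  have hlow : hD.eigenvalues₀ i - δ ≤ hA.eigenvalues₀ i := by
    refine le_of_card_lt_le hA.eigenvalues₀_antitone hD.eigenvalues₀_antitone ?_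
    rw [card_eigenvalues₀ hA fun y => y < hD.eigenvalues₀ i - δ,
      card_eigenvalues_diag h₁ h₂ hD fun y => y < hD.eigenvalues₀ i]
    -- The same isometries diagonalize the negated forms, and the coupling estimate is two-sided.
    have key := card_gt_le_of_form_le (d := fun j => - hA.eigenvalues j)
      (d₁ := fun j => - h₁.eigenvalues j) (d₂ := fun j => - h₂.eigenvalues j)
      (x := - hD.eigenvalues₀ i)
      (fun w => (hP w).1) (fun w => (hP₁ w).1) (fun w => (hP₂ w).1)
      (e := ‖E‖) (fun u v => ?_) (fun j hj => ?_) (fun j hj => ?_) ha' hb' he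
    · simpa only [neg_lt_neg_iff, ← neg_sub', neg_add_eq_sub, ← neg_sub (hD.eigenvalues₀ i) δ]
        using key
    · simp only [neg_mul, Finset.sum_neg_distrib]
      linarith [(abs_le.mp (hq u v)).1]
    · have := ha j
      rw [abs_of_nonpos (by linarith)] at this
      linarith
    · have := hb j
      rw [abs_of_nonpos (by linarith)] at this
      linarith
  rw [abs_le]
  constructor <;> linarith

/-! ### The bound as a function of the gap -/

lemma bound_nonneg (e : ℝ) {t : ℝ} (ht : 0 ≤ t) : 0 ≤ bound e t := by
  unfold bound
  positivity

lemma bound_mul_bound_add (e : ℝ) {t : ℝ} (ht : 0 ≤ t) :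
    bound e t * (bound e t + t) = e ^ 2 := by
  have hs := Real.sq_sqrt (show 0 ≤ t ^ 2 + 4 * e ^ 2 by positivity)
  have hs0 := Real.sqrt_nonneg (t ^ 2 + 4 * e ^ 2)
  unfold bound
  set s := √(t ^ 2 + 4 * e ^ 2)
  rcases (add_nonneg ht hs0).eq_or_lt with h | h
  -- A zero denominator forces `e = 0` too, so the default value of `0 / 0` is the right root.
  · have h1 : t = 0 := by linarith
    have h2 : s = 0 := by linarith
    rw [h1, h2] at hs ⊢
    simp only [add_zero, div_zero, zero_mul]
    linarith
  · have h' := h.ne'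
    field_simp
    linear_combination (-e ^ 2) * hs

lemma bound_antitone (e : ℝ) {s t : ℝ} (hs : 0 ≤ s) (hst : s ≤ t) : bound e t ≤ bound e s := by
  rcases eq_or_ne e 0 with rfl | he
  · simp [bound]
  · have : 0 < e ^ 2 := by positivity
    unfold bound
    gcongr

/-! ### Gaps as attained minima -/

section Gap

lemma isLeast_sInf_distances {k : ℕ} (hk : 0 < k) (x : ℝ) {H : Matrix (Fin k) (Fin k) ℂ}
    (hH : H.IsHermitian) : IsLeast (distances x H) (sInf (distances x H)) := by
  have himage : distances x H = (fun μ => |x - μ|) '' spectrum ℝ H := by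
    ext d
    simp [distances, eq_comm]
  have hfin : (distances x H).Finite := himage ▸ finite_real_spectrum.image _
  have hne : (distances x H).Nonempty :=
    ⟨_, hH.eigenvalues ⟨0, hk⟩, hH.eigenvalues_mem_spectrum_real _, rfl⟩
  exact ⟨hne.csInf_mem hfin, fun d hd => csInf_le hfin.bddBelow hd⟩

lemma isLeast_distances_of_mem {k : ℕ} {x : ℝ} {H : Matrix (Fin k) (Fin k) ℂ}
    (hx : x ∈ spectrum ℝ H) : IsLeast (distances x H) 0 :=
  ⟨⟨x, hx, by simp⟩, by rintro d ⟨μ, -, rfl⟩; exact abs_nonneg _⟩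

variable {m n : ℕ} {H₁ : Matrix (Fin m) (Fin m) ℂ} {H₂ : Matrix (Fin n) (Fin n) ℂ} {x : ℝ}

lemma isLeast_gapAt_left (hn : 0 < n) (h₂ : H₂.IsHermitian) (hx : x ∈ spectrum ℝ H₁) :
    IsLeast (distances x H₂) (gapAt H₁ H₂ x) := by
  rw [gapAt, if_pos hx]
  exact isLeast_sInf_distances hn x h₂

lemma isLeast_gapAt_right (hm : 0 < m) (h₁ : H₁.IsHermitian) (hx : x ∈ spectrum ℝ H₂) :
    IsLeast (distances x H₁) (gapAt H₁ H₂ x) := by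
  by_cases hx₁ : x ∈ spectrum ℝ H₁
  -- For a common eigenvalue the definition measures to `H₂`, but both distances are 0.
  · rw [gapAt, if_pos hx₁, (isLeast_distances_of_mem hx).csInf_eq]
    exact isLeast_distances_of_mem hx₁
  · rw [gapAt, if_neg hx₁]
    exact isLeast_sInf_distances hm x h₁

lemma exists_eigenvalues₀_diag_eq_iff (h₁ : H₁.IsHermitian) (h₂ : H₂.IsHermitian)
    (hD : (diag H₁ H₂).IsHermitian) :
    (∃ i, hD.eigenvalues₀ i = x) ↔ x ∈ spectrum ℝ H₁ ∨ x ∈ spectrum ℝ H₂ := by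
  have h := congrArg (x ∈ ·) (map_eigenvalues_diag h₁ h₂ hD)
  simp only [Multiset.mem_add, Multiset.mem_map, Finset.mem_val, Finset.mem_univ, true_and] at h
  rw [h, h₁.spectrum_real_eq_range_eigenvalues, h₂.spectrum_real_eq_range_eigenvalues,
    Set.mem_range, Set.mem_range]

end Gap

end BlockPerturbation

theorem theorem2 {m n : ℕ} (hm : 0 < m) (hn : 0 < n)
    (H₁ : Matrix (Fin m) (Fin m) ℂ) (H₂ : Matrix (Fin n) (Fin n) ℂ)
    (E : Matrix (Fin n) (Fin m) ℂ)
    (hA : (BlockPerturbation.full H₁ H₂ E).IsHermitian)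
    (hD : (BlockPerturbation.diag H₁ H₂).IsHermitian) :
    -- every eigenvalue of the block diagonal matrix is one of `H₁` or of `H₂`, and its gap is
    -- the minimal distance to the spectrum of the other block
    (∀ i, (hD.eigenvalues₀ i ∈ spectrum ℝ H₁ ∨ hD.eigenvalues₀ i ∈ spectrum ℝ H₂) ∧
      (hD.eigenvalues₀ i ∈ spectrum ℝ H₁ →
        IsLeast {d : ℝ | ∃ μ₂ ∈ spectrum ℝ H₂, d = |hD.eigenvalues₀ i - μ₂|}
          (BlockPerturbation.eta hD i)) ∧
      (hD.eigenvalues₀ i ∈ spectrum ℝ H₂ →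
        IsLeast {d : ℝ | ∃ μ₁ ∈ spectrum ℝ H₁, d = |hD.eigenvalues₀ i - μ₁|}
          (BlockPerturbation.eta hD i))) ∧
    -- the least gap is attained, and it is the minimal distance between the two spectra
    IsLeast (Set.range (BlockPerturbation.eta hD)) (BlockPerturbation.etaMin hD) ∧
    IsLeast {d : ℝ | ∃ μ₁ ∈ spectrum ℝ H₁, ∃ μ₂ ∈ spectrum ℝ H₂, d = |μ₁ - μ₂|}
      (BlockPerturbation.etaMin hD) ∧
    -- the eigenvalue bounds
    ∀ i, |hA.eigenvalues₀ i - hD.eigenvalues₀ i| ≤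
          BlockPerturbation.bound ‖E‖ (BlockPerturbation.eta hD i) ∧
        BlockPerturbation.bound ‖E‖ (BlockPerturbation.eta hD i) ≤
          BlockPerturbation.bound ‖E‖ (BlockPerturbation.etaMin hD) := by
  obtain ⟨h₁, -, -, h₂⟩ := Matrix.isHermitian_fromBlocks_iff.mp hD
  have hspec : ∀ i, hD.eigenvalues₀ i ∈ spectrum ℝ H₁ ∨ hD.eigenvalues₀ i ∈ spectrum ℝ H₂ :=
    fun i => (BlockPerturbation.exists_eigenvalues₀_diag_eq_iff h₁ h₂ hD).mp ⟨i, rfl⟩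
  have hl : ∀ i, hD.eigenvalues₀ i ∈ spectrum ℝ H₁ →
      IsLeast (BlockPerturbation.distances (hD.eigenvalues₀ i) H₂) (BlockPerturbation.eta hD i) :=
    fun i hi => BlockPerturbation.isLeast_gapAt_left hn h₂ hi
  have hr : ∀ i, hD.eigenvalues₀ i ∈ spectrum ℝ H₂ →
      IsLeast (BlockPerturbation.distances (hD.eigenvalues₀ i) H₁) (BlockPerturbation.eta hD i) :=
    fun i hi => BlockPerturbation.isLeast_gapAt_right hm h₁ hi
  have hne : Nonempty (Fin (Fintype.card (Fin m ⊕ Fin n))) :=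
    Fin.pos_iff_nonempty.mp (by simp only [Fintype.card_sum, Fintype.card_fin]; omega)
  have hmin : ∀ i, BlockPerturbation.etaMin hD ≤ BlockPerturbation.eta hD i :=
    fun i => ciInf_le (Set.finite_range _).bddBelow i
  obtain ⟨k, hk⟩ := exists_eq_ciInf_of_finite (f := BlockPerturbation.eta hD)
  have hk' : BlockPerturbation.eta hD k = BlockPerturbation.etaMin hD := hk
  have hnonneg : ∀ i, 0 ≤ BlockPerturbation.eta hD i := fun i => by
    rcases hspec i with hi | hi
    · obtain ⟨μ, -, h⟩ := (hl i hi).1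
      exact h ▸ abs_nonneg _
    · obtain ⟨μ, -, h⟩ := (hr i hi).1
      exact h ▸ abs_nonneg _
  refine ⟨fun i => ⟨hspec i, hl i, hr i⟩, ⟨⟨k, hk'⟩, ?_⟩, ⟨?_, ?_⟩, fun i => ⟨?_, ?_⟩⟩
  · rintro _ ⟨i, rfl⟩
    exact hmin i
  · rw [← hk']
    rcases hspec k with hi | hi
    · obtain ⟨μ, hμ, h⟩ := (hl k hi).1
      exact ⟨_, hi, μ, hμ, h⟩
    · obtain ⟨μ, hμ, h⟩ := (hr k hi).1
      exact ⟨μ, hμ, _, hi, by rw [h, abs_sub_comm]⟩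
  · rintro _ ⟨μ₁, hμ₁, μ₂, hμ₂, rfl⟩
    obtain ⟨i, rfl⟩ := (BlockPerturbation.exists_eigenvalues₀_diag_eq_iff h₁ h₂ hD).mpr (Or.inl hμ₁)
    exact (hmin i).trans ((hl i hμ₁).2 ⟨μ₂, hμ₂, rfl⟩)
  · have hb := BlockPerturbation.bound_nonneg ‖E‖ (hnonneg i)
    have hprod := BlockPerturbation.bound_mul_bound_add ‖E‖ (hnonneg i)
    rcases hspec i with hi | hi
    -- The block having this eigenvalue gets gap 0, the other one gets `η i`.
    · exact BlockPerturbation.abs_eigenvalues_sub_le h₁ h₂ hA hD i (a := 0)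
        (fun j => abs_nonneg _)
        (fun j => (hl i hi).2 ⟨_, h₂.eigenvalues_mem_spectrum_real j, rfl⟩)
        (by linarith) (add_nonneg hb (hnonneg i)) (by rw [add_zero, hprod])
    · exact BlockPerturbation.abs_eigenvalues_sub_le h₁ h₂ hA hD i (b := 0)
        (fun j => (hr i hi).2 ⟨_, h₁.eigenvalues_mem_spectrum_real j, rfl⟩)
        (fun j => abs_nonneg _)
        (add_nonneg hb (hnonneg i)) (by linarith) (by rw [add_zero, mul_comm, hprod])
  · exact BlockPerturbation.bound_antitone ‖E‖ (hk' ▸ hnonneg k) (hmin i)
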